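/- Let $\Omega\subset\mathbb{R}^2$ be a bounded domain with $C^2$ boundary whose curvature $\kappa$ with respect to the inward normal satisfies $\kappa\ge 0$ on $\partial\Omega$. Let $\varepsilon>0$ and let $\mathcal N_\varepsilon=\{x\in\overline\Omega:\operatorname{dist}(x,\partial\Omega)<\varepsilon\}$. Then for all real numbers $C_1$ and $M\ge 0$ there is a constant $C_2=C_2(\Omega,\varepsilon,C_1,M)$ with the following property. Let $\varphi\in C^2(\overline{\mathcal N_\varepsilon})$ with $$\|\varphi\|_{2;\overline{\mathcal N_\varepsilon}}=\sup_{\mathcal N_\varepsilon}|\varphi|+\sup_{\mathcal N_\varepsilon}|D\varphi|+\sup_{\mathcal N_\varepsilon}|D^2\varphi|\le M,$$ and let $u\in C^2(\Omega)\cap C^1(\overline\Omega)$ be a solution of the Dirichlet problem $$\operatorname{div}\left(\frac{Du}{\sqrt{1+|Du|^2}}\right)=\frac{1}{\sqrt{1+|Du|^2}}\ \text{ in }\Omega,\qquad u=\varphi\ \text{ on }\partial\Omega,$$ such that $C_1\le u$ in $\Omega$. Then $$\max_{\partial\Omega}|Du|\le C_2.$$ -/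

import Mathlib

open scoped NNReal ENNReal

noncomputable section

namespace Soliton

/-- The Euclidean plane. -/
abbrev Plane : Type := EuclideanSpace ℝ (Fin 2)

/-- Near the point `p`, and in the Cartesian coordinates `(s, t)` given by the orthonormal basis `b`,
the set `Ω` is the strict epigraph `{t > f s}` of the `C²` function `f`. -/
structure IsBoundaryGraph (Ω : Set Plane) (p : Plane) (b : OrthonormalBasis (Fin 2) ℝ Plane)
    (f : ℝ → ℝ) : Prop where
  contDiff : ContDiff ℝ 2 f
  eventually_mem_iff : ∀ᶠ x in nhds p, x ∈ Ω ↔ f (b.repr x 0) < b.repr x 1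

/-- A domain (nonempty, open, connected) of the plane with `C²` boundary: near each of its boundary
points, it is the epigraph of a `C²` function in suitable Cartesian coordinates. -/
structure IsC2Domain (Ω : Set Plane) : Prop where
  isOpen : IsOpen Ω
  isConnected : IsConnected Ω
  exists_graph : ∀ p ∈ frontier Ω, ∃ (b : OrthonormalBasis (Fin 2) ℝ Plane) (f : ℝ → ℝ),
    IsBoundaryGraph Ω p b f

/-- `k` is the curvature of `∂Ω` at `p` with respect to the inward unit normal. If `Ω` is `{t > f s}`
near `p`, the inward normal is `(-f', 1) / √(1 + f'²)` and the curvature with respect to it is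
`f'' / (1 + f'²)^(3/2)`. The value does not depend on the graph representation; a disc of radius `R`
has curvature `1 / R`. -/
def HasInwardCurvature (Ω : Set Plane) (p : Plane) (k : ℝ) : Prop :=
  ∃ (b : OrthonormalBasis (Fin 2) ℝ Plane) (f : ℝ → ℝ), IsBoundaryGraph Ω p b f ∧
    k = deriv (deriv f) (b.repr p 0) / (1 + deriv f (b.repr p 0) ^ 2) ^ (3 / 2 : ℝ)

/-- The part in `Ω` of the tubular neighbourhood of width `ε` of `∂Ω`. -/
def innerTube (Ω : Set Plane) (ε : ℝ) : Set Plane :=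
  {x | x ∈ Ω ∧ Metric.infDist x (frontier Ω) < ε}

/-- `f ∈ C²(closure U)`, for `U` open: `f` is continuous on the closure of `U`, it is `C²` in `U`, and
its derivatives up to order two extend continuously to the closure of `U`. -/
def IsC2OnClosure (f : Plane → ℝ) (U : Set Plane) : Prop :=
  ContinuousOn f (closure U) ∧ ContDiffOn ℝ 2 f U ∧
    ∀ m : ℕ, m ≤ 2 → ∃ g : Plane → ContinuousMultilinearMap ℝ (fun _ : Fin m => Plane) ℝ,
      ContinuousOn g (closure U) ∧ ∀ x ∈ U, g x = iteratedFDeriv ℝ m f x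

/-- The `C²` norm `sup |f| + sup |Df| + sup |D²f|`, suprema over the open set `U`. For
`f ∈ C²(closure U)` the suprema over the closure of `U` are the same. -/
def c2Norm (f : Plane → ℝ) (U : Set Plane) : ℝ≥0∞ :=
  ∑ m ∈ Finset.range 3, ⨆ x ∈ U, ‖iteratedFDeriv ℝ m f x‖ₑ

/-- `u ∈ C¹(closure Ω)`, for `Ω` open, and `Du` is its gradient, extended continuously to the closure
of `Ω`. -/
structure IsC1OnClosure (u : Plane → ℝ) (Du : Plane → Plane) (Ω : Set Plane) : Prop where
  continuousOn : ContinuousOn u (closure Ω)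
  continuousOn_gradient : ContinuousOn Du (closure Ω)
  hasGradientAt : ∀ x ∈ Ω, HasGradientAt u (Du x) x

/-- The divergence of a vector field of the plane. -/
def divergence (X : Plane → Plane) (x : Plane) : ℝ :=
  ∑ i : Fin 2, fderiv ℝ X x (EuclideanSpace.single i 1) i

/-- The translating soliton equation `div (Du / √(1 + |Du|²)) = 1 / √(1 + |Du|²)` in `Ω`. -/
def SolvesTranslatingSoliton (u : Plane → ℝ) (Ω : Set Plane) : Prop :=
  ∀ x ∈ Ω, divergence (fun y => (1 / √(1 + ‖gradient u y‖ ^ 2)) • gradient u y) x =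
    1 / √(1 + ‖gradient u x‖ ^ 2)

end Soliton

end

namespace Soliton

open Set Filter Topology

/-! Nonnegative curvature makes Ω convex (`IsC2Domain.convex`), so every boundary point p has a
supporting line, with unit normal e, and d(x) = ⟨e, x - p⟩ is affine and positive on Ω. Cleared of
denominators, the equation reads Qu = 1 + |Du|² with Qu = (1 + |Du|²)Δu - uᵢuⱼuᵢⱼ.

In the strip d < δ, u is compared with φ + ψ(d), where ψ is a logarithm with ψ'' = -Kψ'². Since d is
affine, an interior maximum of u - φ - ψ(d) would force Qu ≤ 2M + M|Du|² + ψ'' with |Du| ≤ M + ψ',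
which is incompatible with Qu ≥ -(1 + |Du|²) for large K (`not_isLocalMax_sub_barrier`). Only this
lower bound on Qu is used and Q is odd, so the comparison `le_add_barrier` applies to u and to -u.
On d = δ it needs a bound for |u - φ|: C₁ bounds u below, the maximum principle bounds it above by
M.

Hence |u - u(p)| ≤ (M + c)|x - p| near p, with c independent of p. This bounds ⟨Du(p), x - p⟩ for
all x in Ω, and a fixed ball inside Ω turns that into a bound for the whole vector Du(p). -/

/-! ### Nonnegative boundary curvature implies convexity -/

/-- A connected open set that is convex near each of its boundary points is convex. -/
theorem convex_of_locally_convex {E : Type*} [NormedAddCommGroup E] [NormedSpace ℝ E] {Ω : Set E}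
    (ho : IsOpen Ω) (hc : IsPreconnected Ω)
    (hloc : ∀ p ∈ frontier Ω, ∃ r > 0, Convex ℝ (Ω ∩ Metric.ball p r)) : Convex ℝ Ω := by
  -- At the first exit point of the segment, local convexity applies: a point just before is
  -- interior and one just after lies in the closure, so their midpoint, the exit point, is
  -- interior.
  have key : ∀ x ∈ Ω, ∀ y ∈ Ω, segment ℝ x y ⊆ closure Ω → segment ℝ x y ⊆ Ω := by
    intro x hx y hy hxy
    set γ : ℝ → E := fun t => AffineMap.lineMap x y t with hγ
    have hγc : Continuous γ := by
      simp only [hγ]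
      exact AffineMap.lineMap_continuous
    have hγcl : ∀ t ∈ Icc (0 : ℝ) 1, γ t ∈ closure Ω := fun t ht =>
      hxy (by rw [segment_eq_image_lineMap]; exact ⟨t, ht, rfl⟩)
    suffices h : ∀ t ∈ Icc (0 : ℝ) 1, γ t ∈ Ω by
      rw [segment_eq_image_lineMap]
      rintro _ ⟨t, ht, rfl⟩
      exact h t ht
    by_contra! hbad
    set S : Set ℝ := Icc (0 : ℝ) 1 ∩ γ ⁻¹' Ωᶜ with hS
    have hSc : IsCompact S :=
      isCompact_Icc.inter_right (ho.isClosed_compl.preimage hγc)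
    have hSn : S.Nonempty := by
      obtain ⟨t, ht, h⟩ := hbad
      exact ⟨t, ht, h⟩
    obtain ⟨t₀, ⟨ht₀, hnot⟩, hmin⟩ := hSc.exists_isLeast hSn
    have hlt : ∀ t, 0 ≤ t → t < t₀ → γ t ∈ Ω := by
      intro t h0 h1
      by_contra h
      exact absurd (hmin ⟨⟨h0, h1.le.trans ht₀.2⟩, h⟩) (not_le.2 h1)
    have h0 : 0 < t₀ := by
      rcases ht₀.1.eq_or_lt with h | h
      · exact absurd (by simpa [hγ, ← h] using hx) hnot
      · exact h
    have h1 : t₀ < 1 := by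
      rcases ht₀.2.eq_or_lt with h | h
      · exact absurd (by simpa [hγ, h] using hy) hnot
      · exact h
    obtain ⟨r, hr, hconv⟩ := hloc (γ t₀) ⟨hγcl _ ht₀, by rwa [ho.interior_eq]⟩
    have hball : ∀ᶠ t in 𝓝 t₀, γ t ∈ Metric.ball (γ t₀) r :=
      hγc.continuousAt.eventually (Metric.ball_mem_nhds _ hr)
    obtain ⟨η, hη, hball⟩ := Metric.eventually_nhds_iff_ball.1 hball
    set τ := min (η / 2) (min t₀ (1 - t₀)) with hτ
    have hτ0 : 0 < τ := lt_min (by linarith) (lt_min h0 (by linarith))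
    have hτη : τ < η := (min_le_left _ _).trans_lt (by linarith)
    have hτ1 : τ ≤ t₀ := (min_le_right _ _).trans (min_le_left _ _)
    have hτ2 : τ ≤ 1 - t₀ := (min_le_right _ _).trans (min_le_right _ _)
    have hopen : IsOpen (Ω ∩ Metric.ball (γ t₀) r) := ho.inter Metric.isOpen_ball
    have ha : γ (t₀ - τ) ∈ interior (Ω ∩ Metric.ball (γ t₀) r) := by
      rw [hopen.interior_eq]
      refine ⟨hlt _ (by linarith) (by linarith), hball _ ?_⟩
      rw [Metric.mem_ball, Real.dist_eq, abs_lt]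
      constructor <;> linarith
    have hb : γ (t₀ + τ) ∈ closure (Ω ∩ Metric.ball (γ t₀) r) := by
      refine Metric.isOpen_ball.closure_inter ⟨hγcl _ ⟨by linarith, by linarith⟩, hball _ ?_⟩
      rw [Metric.mem_ball, Real.dist_eq, abs_lt]
      constructor <;> linarith
    have hmem := hconv.openSegment_interior_closure_subset_interior ha hb
      (show γ t₀ ∈ openSegment ℝ (γ (t₀ - τ)) (γ (t₀ + τ)) by
        refine ⟨1 / 2, 1 / 2, by norm_num, by norm_num, by norm_num, ?_⟩
        simp only [hγ, AffineMap.lineMap_apply_module]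
        module)
    exact hnot (interior_subset hmem).1
  intro x hx
  rw [starConvex_iff_segment_subset]
  -- The points visible from x form an open set, by compactness of [0, 1], that is relatively closed
  -- in Ω, by `key`; connectedness makes it contain Ω.
  set S : Set E := {y | segment ℝ x y ⊆ Ω} with hS
  have hSopen : IsOpen S := by
    rw [isOpen_iff_mem_nhds]
    intro y hy
    have hcomp : IsCompact (Icc (0 : ℝ) 1) := isCompact_Icc
    have := hcomp.eventually_forall_of_forall_eventually (x₀ := y)
      (P := fun z t => AffineMap.lineMap x z t ∈ Ω) (by
        intro t ht
        have hcont : Continuous fun q : E × ℝ => AffineMap.lineMap x q.1 q.2 := by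
          simp only [AffineMap.lineMap_apply_module]
          fun_prop
        refine hcont.continuousAt.eventually (ho.mem_nhds (hy ?_))
        rw [segment_eq_image_lineMap]
        exact ⟨t, ht, rfl⟩)
    filter_upwards [this] with z hz
    rw [hS, mem_ofPred_eq, segment_eq_image_lineMap]
    rintro _ ⟨t, ht, rfl⟩
    exact hz t ht
  have hsub : closure S ∩ Ω ⊆ S := by
    rintro y ⟨hy, hyΩ⟩
    refine key x hx y hyΩ ?_
    rw [segment_eq_image_lineMap]
    rintro _ ⟨t, ht, rfl⟩
    have hcont : Continuous fun z : E => AffineMap.lineMap x z t := by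
      simp only [AffineMap.lineMap_apply_module]
      fun_prop
    have hmaps : MapsTo (fun z : E => AffineMap.lineMap x z t) S Ω := by
      intro z hz
      refine (show segment ℝ x z ⊆ Ω from hz) ?_
      rw [segment_eq_image_lineMap]
      exact ⟨t, ht, rfl⟩
    exact hmaps.closure hcont hy
  have : Ω ⊆ S := by
    refine hc.subset_of_closure_inter_subset hSopen ⟨x, hx, ?_⟩ hsub
    simpa [hS] using hx
  exact fun y hy => this hy

theorem IsBoundaryGraph.eq_of_mem_frontier {Ω : Set Plane} {p : Plane}
    {b : OrthonormalBasis (Fin 2) ℝ Plane} {f : ℝ → ℝ} (h : IsBoundaryGraph Ω p b f)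
    (ho : IsOpen Ω) (hp : p ∈ frontier Ω) : f (b.repr p 0) = b.repr p 1 := by
  have hf := h.contDiff.continuous
  have hc : Continuous fun x : Plane => f (b.repr x 0) := by fun_prop
  have hc' : Continuous fun x : Plane => b.repr x 1 := by fun_prop
  rw [ho.frontier_eq] at hp
  refine le_antisymm ?_ ?_
  · by_contra! hlt
    have hev : ∀ᶠ x in 𝓝 p, b.repr x 1 < f (b.repr x 0) :=
      hc'.continuousAt.eventually_lt hc.continuousAt hlt
    obtain ⟨x, hx, h1, h2⟩ :=
      ((mem_closure_iff_frequently.1 hp.1).and_eventually (hev.and h.eventually_mem_iff)).exists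
    exact absurd (h2.1 hx) (not_lt.2 h1.le)
  · by_contra! hlt
    exact hp.2 (h.eventually_mem_iff.self_of_nhds.2 hlt)

theorem IsBoundaryGraph.mem_frontier {Ω : Set Plane} {p : Plane}
    {b : OrthonormalBasis (Fin 2) ℝ Plane} {f : ℝ → ℝ} (h : IsBoundaryGraph Ω p b f)
    (ho : IsOpen Ω) (hp : f (b.repr p 0) = b.repr p 1) : p ∈ frontier Ω := by
  rw [ho.frontier_eq]
  refine ⟨?_, fun hmem => absurd (h.eventually_mem_iff.self_of_nhds.1 hmem) (by rw [hp]; exact lt_irrefl _)⟩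
  have hcont : Tendsto (fun t : ℝ => p + t • b 1) (𝓝[>] 0) (𝓝 p) := by
    have : Continuous fun t : ℝ => p + t • b 1 := by fun_prop
    simpa using (this.tendsto 0).mono_left nhdsWithin_le_nhds
  refine mem_closure_of_tendsto hcont ?_
  filter_upwards [hcont.eventually h.eventually_mem_iff, self_mem_nhdsWithin] with t ht ht0
  rw [ht]
  simpa [hp] using ht0

/-- Convexity of f needs f'' ≥ 0 on an interval, not just at p. The chart at p also represents Ω
near neighbouring points of the graph, where the curvature hypothesis gives the sign. -/
theorem IsC2Domain.locally_convex {Ω : Set Plane} (hΩ : IsC2Domain Ω)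
    (hκ : ∀ p ∈ frontier Ω, ∀ κ : ℝ, HasInwardCurvature Ω p κ → 0 ≤ κ) :
    ∀ p ∈ frontier Ω, ∃ r > 0, Convex ℝ (Ω ∩ Metric.ball p r) := by
  intro p hp
  obtain ⟨b, f, h⟩ := hΩ.exists_graph p hp
  have hpf := h.eq_of_mem_frontier hΩ.isOpen hp
  have hfc := h.contDiff.continuous
  set γ : ℝ → Plane := fun s => s • b 0 + f s • b 1 with hγ
  have hγc : Continuous γ := by fun_prop
  have hγ0 : ∀ s, b.repr (γ s) 0 = s := fun s => by simp [hγ]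
  have hγ1 : ∀ s, b.repr (γ s) 1 = f s := fun s => by simp [hγ]
  have hγp : γ (b.repr p 0) = p := by
    apply b.repr.injective
    ext i
    fin_cases i
    · exact hγ0 _
    · exact (hγ1 _).trans hpf
  have hev : ∀ᶠ s in 𝓝 (b.repr p 0), 0 ≤ deriv (deriv f) s := by
    have h1 := (hγc.tendsto (b.repr p 0))
    rw [hγp] at h1
    filter_upwards [h1.eventually (eventually_eventually_nhds.2 h.eventually_mem_iff)] with s hs
    have hg : IsBoundaryGraph Ω (γ s) b f := ⟨h.contDiff, hs⟩
    have := hκ (γ s) (hg.mem_frontier hΩ.isOpen (by rw [hγ0, hγ1])) _ ⟨b, f, hg, rfl⟩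
    rw [hγ0] at this
    have hpos : 0 < (1 + deriv f s ^ 2) ^ (3 / 2 : ℝ) := by positivity
    by_contra! hneg
    exact absurd this (not_le.2 (div_neg_of_neg_of_pos hneg hpos))
  obtain ⟨r₁, hr₁, h₁⟩ := Metric.eventually_nhds_iff_ball.1 hev
  obtain ⟨r₂, hr₂, h₂⟩ := Metric.eventually_nhds_iff_ball.1 h.eventually_mem_iff
  have hconv : ConvexOn ℝ (Metric.ball (b.repr p 0) r₁) f := by
    have hd : Differentiable ℝ f := h.contDiff.differentiable (by norm_num)
    have hd' : Differentiable ℝ (deriv f) :=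
      ((contDiff_succ_iff_deriv (n := 1)).1 h.contDiff).2.2.differentiable (by norm_num)
    refine convexOn_of_deriv2_nonneg (convex_ball _ _) hfc.continuousOn hd.differentiableOn
      hd'.differentiableOn fun s hs => ?_
    exact h₁ s (interior_subset hs)
  refine ⟨min r₁ r₂, lt_min hr₁ hr₂, ?_⟩
  have hcoord : ∀ x ∈ Metric.ball p (min r₁ r₂), b.repr x 0 ∈ Metric.ball (b.repr p 0) r₁ := by
    intro x hx
    rw [Metric.mem_ball, dist_eq_norm] at hx ⊢
    have := PiLp.norm_apply_le (b.repr (x - p)) 0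
    rw [b.repr.norm_map, map_sub] at this
    exact this.trans_lt (hx.trans_le (min_le_left _ _))
  rintro x ⟨hxΩ, hx⟩ y ⟨hyΩ, hy⟩ s t hs ht hst
  have hz := convex_ball p (min r₁ r₂) hx hy hs ht hst
  have hball : Metric.ball p (min r₁ r₂) ⊆ Metric.ball p r₂ := Metric.ball_subset_ball (min_le_right _ _)
  refine ⟨(h₂ _ (hball hz)).2 ?_, hz⟩
  have hx' := (h₂ _ (hball hx)).1 hxΩ
  have hy' := (h₂ _ (hball hy)).1 hyΩ
  have := hconv.2 (hcoord x hx) (hcoord y hy) hs ht hst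
  simp only [map_add, map_smul, PiLp.add_apply, PiLp.smul_apply, smul_eq_mul] at this ⊢
  refine this.trans_lt ?_
  rcases hs.eq_or_lt with rfl | hs
  · have : t = 1 := by linarith
    subst this
    simpa using hy'
  · have := mul_lt_mul_of_pos_left hx' hs
    have := mul_le_mul_of_nonneg_left hy'.le ht
    linarith

theorem IsC2Domain.convex {Ω : Set Plane} (hΩ : IsC2Domain Ω)
    (hκ : ∀ p ∈ frontier Ω, ∀ κ : ℝ, HasInwardCurvature Ω p κ → 0 ≤ κ) : Convex ℝ Ω :=
  convex_of_locally_convex hΩ.isOpen hΩ.isConnected.isPreconnected (hΩ.locally_convex hκ)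


/-! ### Calculus along lines -/

/-- The necessary first and second order conditions at a local maximum on the line. -/
theorem deriv_conditions_of_isLocalMax {h h' : ℝ → ℝ} {h'' a : ℝ} (hmax : IsLocalMax h a)
    (h1 : ∀ᶠ t in 𝓝 a, HasDerivAt h (h' t) t) (h2 : HasDerivAt h' h'' a) : h' a = 0 ∧ h'' ≤ 0 := by
  have h0 : h' a = 0 := hmax.hasDerivAt_eq_zero h1.self_of_nhds
  refine ⟨h0, ?_⟩
  by_contra! hpos
  have hd : deriv h =ᶠ[𝓝 a] h' := h1.mono fun t ht => ht.deriv
  have hdd : deriv (deriv h) a = h'' := by rw [hd.deriv_eq, h2.deriv]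
  -- If h'' > 0, the point is also a local minimum, so h is locally constant and h'' = 0.
  have hmin : IsLocalMin h a := isLocalMin_of_deriv_deriv_pos (by rwa [hdd])
    (by rw [h1.self_of_nhds.deriv, h0]) h1.self_of_nhds.continuousAt
  have hconst : h =ᶠ[𝓝 a] fun _ => h a := by
    filter_upwards [hmax, hmin] with t ht1 ht2 using le_antisymm ht1 ht2
  have hz : deriv h =ᶠ[𝓝 a] fun _ => 0 := by
    have := hconst.deriv
    simpa using this
  rw [hz.deriv_eq, deriv_const] at hdd
  exact hpos.ne hdd

section Line

variable {E : Type*} [NormedAddCommGroup E] [NormedSpace ℝ E] {g : E → ℝ} {x : E}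

theorem hasDerivAt_line (x v : E) (t : ℝ) : HasDerivAt (fun t : ℝ => x + t • v) v t := by
  simpa using ((hasDerivAt_id t).smul_const v).const_add x

theorem tendsto_line (x v : E) : Tendsto (fun t : ℝ => x + t • v) (𝓝 0) (𝓝 x) := by
  have : Continuous fun t : ℝ => x + t • v := by fun_prop
  simpa using this.tendsto 0

theorem eventually_hasDerivAt_line (hg : ContDiffAt ℝ 2 g x) (v : E) :
    ∀ᶠ t : ℝ in 𝓝 0, HasDerivAt (fun t : ℝ => g (x + t • v)) (fderiv ℝ g (x + t • v) v) t := by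
  have hev : ∀ᶠ y in 𝓝 x, ContDiffAt ℝ 2 g y := hg.eventually (by simp)
  filter_upwards [(tendsto_line x v).eventually hev] with t ht
  exact (ht.differentiableAt (by norm_num)).hasFDerivAt.comp_hasDerivAt t (hasDerivAt_line x v t)

theorem differentiableAt_fderiv (hg : ContDiffAt ℝ 2 g x) : DifferentiableAt ℝ (fderiv ℝ g) x :=
  (hg.fderiv_right (m := 1) (by norm_num)).differentiableAt (by norm_num)

theorem hasDerivAt_fderiv_line (hg : ContDiffAt ℝ 2 g x) (v : E) :
    HasDerivAt (fun t : ℝ => fderiv ℝ g (x + t • v) v) (fderiv ℝ (fderiv ℝ g) x v v) 0 := by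
  have h1 : HasFDerivAt (fderiv ℝ g) (fderiv ℝ (fderiv ℝ g) x) (x + (0 : ℝ) • v) := by
    simpa using (differentiableAt_fderiv hg).hasFDerivAt
  have h2 : HasDerivAt (fun t : ℝ => fderiv ℝ g (x + t • v)) (fderiv ℝ (fderiv ℝ g) x v) 0 :=
    h1.comp_hasDerivAt 0 (hasDerivAt_line x v 0)
  exact (ContinuousLinearMap.apply ℝ ℝ v).hasFDerivAt.comp_hasDerivAt 0 h2

end Line

/-! ### The equation in non-divergence form -/

/-- The rotation of the plane by a right angle. -/
def rot (v : Plane) : Plane := !₂[-v 1, v 0]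

theorem norm_sq_eq (v : Plane) : ‖v‖ ^ 2 = v 0 ^ 2 + v 1 ^ 2 := by
  rw [EuclideanSpace.norm_sq_eq]
  simp

theorem norm_rot (v : Plane) : ‖rot v‖ = ‖v‖ := by
  rw [← sq_eq_sq₀ (norm_nonneg _) (norm_nonneg _), norm_sq_eq, norm_sq_eq]
  simp [rot]
  ring

theorem rot_neg (v : Plane) : rot (-v) = -rot v := by
  ext i
  fin_cases i <;> simp [rot]

/-- The quasilinear operator `(1 + |Du|²) Δu - uᵢ uⱼ uᵢⱼ`, as a trace of the second derivative. -/
noncomputable def meanCurvatureOperator (u : Plane → ℝ) (x : Plane) : ℝ :=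
  fderiv ℝ (fderiv ℝ u) x (EuclideanSpace.single 0 1) (EuclideanSpace.single 0 1) +
  fderiv ℝ (fderiv ℝ u) x (EuclideanSpace.single 1 1) (EuclideanSpace.single 1 1) +
  fderiv ℝ (fderiv ℝ u) x (rot (gradient u x)) (rot (gradient u x))

theorem inner_gradient (u : Plane → ℝ) (x v : Plane) : inner ℝ (gradient u x) v = fderiv ℝ u x v := by
  simp [gradient]

theorem gradient_neg (u : Plane → ℝ) (x : Plane) : gradient (-u) x = -gradient u x := by
  simp [gradient, fderiv_neg]

theorem meanCurvatureOperator_neg (u : Plane → ℝ) (x : Plane) :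
    meanCurvatureOperator (-u) x = -meanCurvatureOperator u x := by
  have h : fderiv ℝ (-u) = -fderiv ℝ u := by
    ext1 y
    exact fderiv_neg
  simp only [meanCurvatureOperator, h, gradient_neg, rot_neg, fderiv_neg, map_neg,
    neg_apply]
  ring

/-- With G = Du, the product rule gives W⁻³(W² tr D²u - D²u(G, G)). In the plane |G|² I - G⊗G = rot
G ⊗ rot G, so the bracket is a sum of pure second directional derivatives, the form suited to
maximum principles. -/
theorem divergence_normalized_gradient {u : Plane → ℝ} {x : Plane} (hu : ContDiffAt ℝ 2 u x) :
    divergence (fun y => (1 / √(1 + ‖gradient u y‖ ^ 2)) • gradient u y) x =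
      meanCurvatureOperator u x / √(1 + ‖gradient u x‖ ^ 2) ^ 3 := by
  set G := gradient u with hG
  set W := √(1 + ‖G x‖ ^ 2) with hW
  have hpos : 0 < 1 + ‖G x‖ ^ 2 := by positivity
  have hWpos : 0 < W := Real.sqrt_pos.2 hpos
  have hWsq : W ^ 2 = 1 + ‖G x‖ ^ 2 := Real.sq_sqrt hpos.le
  have hGd : DifferentiableAt ℝ G x :=
    (InnerProductSpace.toDual ℝ Plane).symm.toContinuousLinearEquiv.differentiableAt.comp x
      (differentiableAt_fderiv hu)
  set H := fderiv ℝ G x with hH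
  have hHG : HasFDerivAt G H x := hGd.hasFDerivAt
  have hHB : ∀ v w, inner ℝ (H v) w = fderiv ℝ (fderiv ℝ u) x v w := by
    intro v w
    have h1 : HasFDerivAt (fun y => inner ℝ (G y) w) (fderiv ℝ (fun y => inner ℝ (G y) w) x) x :=
      (hGd.inner ℝ (differentiableAt_const w)).hasFDerivAt
    have h2 : fderiv ℝ (fun y => inner ℝ (G y) w) x v = inner ℝ (H v) w := by
      rw [fderiv_inner_apply ℝ hGd (differentiableAt_const w)]
      simp [hH]
    have h3 : (fun y => inner ℝ (G y) w) = fun y => fderiv ℝ u y w := by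
      ext y
      exact inner_gradient u y w
    rw [← h2, h3]
    have h4 := (differentiableAt_fderiv hu).hasFDerivAt.clm_apply (hasFDerivAt_const w x)
    rw [h4.fderiv]
    simp
  have hn : HasFDerivAt (fun y => 1 + ‖G y‖ ^ 2) (2 • (innerSL ℝ (G x)).comp H) x :=
    (hHG.norm_sq).const_add 1
  have hs : HasFDerivAt (fun y => 1 / √(1 + ‖G y‖ ^ 2))
      ((-(1 / W ^ 3)) • (innerSL ℝ (G x)).comp H) x := by
    have h5 : HasDerivAt (fun s : ℝ => 1 / √s) (-(1 / (2 * W)) / W ^ 2) (1 + ‖G x‖ ^ 2) := by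
      have h6 := (Real.hasDerivAt_sqrt hpos.ne').inv (Real.sqrt_pos.2 hpos).ne'
      have h7 : (fun s : ℝ => 1 / √s) = (fun s => √s)⁻¹ := by
        ext s
        simp
      rw [h7]
      exact h6
    refine (h5.comp_hasFDerivAt x hn).congr_fderiv ?_
    rw [← Nat.cast_smul_eq_nsmul ℝ, smul_smul]
    congr 1
    push_cast
    field_simp
  have hX : HasFDerivAt (fun y => (1 / √(1 + ‖G y‖ ^ 2)) • G y) _ x := hs.smul hHG
  rw [divergence, hX.fderiv]
  have hcoord : ∀ v : Plane, ∀ i : Fin 2, v i = inner ℝ v (EuclideanSpace.single i (1 : ℝ)) := by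
    intro v i
    simp [EuclideanSpace.inner_single_right]
  have hdec : G x = G x 0 • EuclideanSpace.single 0 (1 : ℝ) + G x 1 • EuclideanSpace.single 1 1 := by
    ext i
    fin_cases i <;> simp
  have hrot : rot (G x) =
      (-G x 1) • EuclideanSpace.single 0 (1 : ℝ) + G x 0 • EuclideanSpace.single 1 1 := by
    ext i
    fin_cases i <;> simp [rot]
  have hGH : ∀ v, inner ℝ (G x) (H v) =
      G x 0 * fderiv ℝ (fderiv ℝ u) x v (EuclideanSpace.single 0 (1 : ℝ)) +
      G x 1 * fderiv ℝ (fderiv ℝ u) x v (EuclideanSpace.single 1 (1 : ℝ)) := by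
    intro v
    rw [real_inner_comm, hHB]
    conv_lhs => rw [hdec]
    simp
  have hHi : ∀ v i, H v i = fderiv ℝ (fderiv ℝ u) x v (EuclideanSpace.single i (1 : ℝ)) := by
    intro v i
    rw [hcoord, hHB]
  rw [meanCurvatureOperator, ← hG, hrot]
  rw [norm_sq_eq] at hWsq
  simp only [Fin.sum_univ_two, add_apply, smul_apply,
    ContinuousLinearMap.smulRight_apply, ContinuousLinearMap.comp_apply, innerSL_apply_apply,
    PiLp.add_apply, PiLp.smul_apply, smul_eq_mul, hGH, hHi, map_add, map_smul, ← hW]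
  field_simp
  rw [hWsq]
  ring

theorem SolvesTranslatingSoliton.meanCurvatureOperator_eq {u : Plane → ℝ} {Ω : Set Plane}
    (h : SolvesTranslatingSoliton u Ω) {x : Plane} (hx : x ∈ Ω) (hu : ContDiffAt ℝ 2 u x) :
    meanCurvatureOperator u x = 1 + ‖gradient u x‖ ^ 2 := by
  have := h x hx
  rw [divergence_normalized_gradient hu] at this
  have hpos : 0 < 1 + ‖gradient u x‖ ^ 2 := by positivity
  have hW := Real.sqrt_pos.2 hpos
  have hWsq := Real.sq_sqrt hpos.le
  rw [div_eq_div_iff (by positivity) hW.ne', one_mul] at this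
  rw [← hWsq]
  apply mul_right_cancel₀ hW.ne'
  rw [this]
  ring


/-! ### The tube and the bounds on φ -/

theorem isOpen_innerTube {Ω : Set Plane} (ho : IsOpen Ω) (ε : ℝ) : IsOpen (innerTube Ω ε) :=
  ho.inter (isOpen_lt (Metric.continuous_infDist_pt _) continuous_const)

theorem norm_iteratedFDeriv_le_of_c2Norm_le {φ : Plane → ℝ} {U : Set Plane} {M : ℝ≥0}
    (h : c2Norm φ U ≤ M) {x : Plane} (hx : x ∈ U) {m : ℕ} (hm : m < 3) :
    ‖iteratedFDeriv ℝ m φ x‖ ≤ M := by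
  have h1 : ‖iteratedFDeriv ℝ m φ x‖ₑ ≤ M := calc
    _ ≤ ⨆ x ∈ U, ‖iteratedFDeriv ℝ m φ x‖ₑ :=
      le_iSup₂ (f := fun x (_ : x ∈ U) => ‖iteratedFDeriv ℝ m φ x‖ₑ) x hx
    _ ≤ c2Norm φ U := Finset.single_le_sum
      (f := fun m => ⨆ x ∈ U, ‖iteratedFDeriv ℝ m φ x‖ₑ) (fun _ _ => zero_le) (Finset.mem_range.2 hm)
    _ ≤ M := h
  rw [enorm_eq_nnnorm] at h1
  exact_mod_cast h1

theorem abs_le_of_c2Norm_le {φ : Plane → ℝ} {U : Set Plane} {M : ℝ≥0}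
    (h : c2Norm φ U ≤ M) {x : Plane} (hx : x ∈ U) : |φ x| ≤ M := by
  simpa using norm_iteratedFDeriv_le_of_c2Norm_le h hx (m := 0) (by norm_num)

theorem norm_fderiv_le_of_c2Norm_le {φ : Plane → ℝ} {U : Set Plane} {M : ℝ≥0}
    (h : c2Norm φ U ≤ M) {x : Plane} (hx : x ∈ U) : ‖fderiv ℝ φ x‖ ≤ M := by
  simpa [norm_iteratedFDeriv_one] using
    norm_iteratedFDeriv_le_of_c2Norm_le h hx (m := 1) (by norm_num)

theorem norm_fderiv_fderiv_le_of_c2Norm_le {φ : Plane → ℝ} {U : Set Plane} {M : ℝ≥0}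
    (h : c2Norm φ U ≤ M) {x : Plane} (hx : x ∈ U) : ‖fderiv ℝ (fderiv ℝ φ) x‖ ≤ M := by
  have := norm_iteratedFDeriv_le_of_c2Norm_le h hx (m := 2) (by norm_num)
  rwa [← norm_iteratedFDeriv_fderiv, norm_iteratedFDeriv_one] at this

theorem c2Norm_neg (φ : Plane → ℝ) (U : Set Plane) : c2Norm (-φ) U = c2Norm φ U := by
  simp only [c2Norm, iteratedFDeriv_neg, Pi.neg_apply, enorm_neg]

/-- If all of `Ω` lies on one side of a line, the distance to the boundary is at most the distance
to the line. -/
theorem infDist_frontier_le_inner {Ω : Set Plane} (ho : IsOpen Ω) {p e : Plane} (he : ‖e‖ = 1)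
    (hl : ∀ x ∈ Ω, 0 < inner ℝ e (x - p)) {x : Plane} (hx : x ∈ Ω) :
    Metric.infDist x (frontier Ω) ≤ inner ℝ e (x - p) := by
  set d := inner ℝ e (x - p) with hd
  -- The foot of the perpendicular lies on the line, hence outside Ω; the segment from x to it must
  -- cross the frontier.
  have hy : x - d • e ∉ Ω := by
    intro h
    have := hl _ h
    rw [sub_right_comm, inner_sub_right, inner_smul_right, real_inner_self_eq_norm_sq, he] at this
    simp [← hd] at this
  obtain ⟨z, hz, hzf⟩ : ∃ z ∈ segment ℝ x (x - d • e), z ∈ frontier Ω := by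
    by_contra! hno
    refine hy ((convex_segment x (x - d • e)).isPreconnected.subset_of_closure_inter_subset ho
      ⟨x, left_mem_segment ℝ _ _, hx⟩ ?_ (right_mem_segment ℝ _ _))
    rintro z ⟨hz, hzs⟩
    by_contra hzΩ
    exact hno z hzs (by rw [ho.frontier_eq]; exact ⟨hz, hzΩ⟩)
  have h1 : dist x z ≤ dist x (x - d • e) := by
    have := (dist_add_dist_of_mem_segment hz)
    linarith [dist_nonneg (x := z) (y := x - d • e)]
  calc _ ≤ dist x z := Metric.infDist_le_dist_of_mem hzf
    _ ≤ _ := h1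
    _ = d := by
      rw [dist_eq_norm, sub_sub_cancel, norm_smul, he, mul_one, Real.norm_of_nonneg (hl x hx).le]

/-! ### Barrier and comparison -/

/-- The barrier `φ + ψ(d)`, where `d` is the distance to a line, cannot be touched from below at an
interior point by a function `u` with `-(1 + |Du|²) ≤ Q u`. -/
theorem not_isLocalMax_sub_barrier {u φ : Plane → ℝ} {p e x : Plane} {ψ ψ' : ℝ → ℝ} {ψ'' M : ℝ}
    (hM : 0 ≤ M) (he : ‖e‖ = 1) (hu : ContDiffAt ℝ 2 u x) (hφ : ContDiffAt ℝ 2 φ x)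
    (hφ1 : ‖fderiv ℝ φ x‖ ≤ M) (hφ2 : ‖fderiv ℝ (fderiv ℝ φ) x‖ ≤ M)
    (hψ1 : ∀ᶠ s in 𝓝 (inner ℝ e (x - p)), HasDerivAt ψ (ψ' s) s)
    (hψ2 : HasDerivAt ψ' ψ'' (inner ℝ e (x - p)))
    (hψ' : 1 ≤ ψ' (inner ℝ e (x - p)))
    (hψ'' : ψ'' ≤ -(4 * (M + 1) ^ 3 * ψ' (inner ℝ e (x - p)) ^ 2))
    (hop : -(1 + ‖gradient u x‖ ^ 2) ≤ meanCurvatureOperator u x) :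
    ¬ IsLocalMax (fun y => u y - φ y - ψ (inner ℝ e (y - p))) x := by
  intro hmax
  set a := ψ' (inner ℝ e (x - p)) with ha
  have key : ∀ v : Plane, fderiv ℝ u x v - fderiv ℝ φ x v - a * inner ℝ e v = 0 ∧
      fderiv ℝ (fderiv ℝ u) x v v - fderiv ℝ (fderiv ℝ φ) x v v - ψ'' * inner ℝ e v * inner ℝ e v
        ≤ 0 := by
    intro v
    have hline : ∀ t : ℝ, HasDerivAt (fun t : ℝ => inner ℝ e (x + t • v - p)) (inner ℝ e v) t := by
      intro t
      exact (innerSL ℝ e).hasFDerivAt.comp_hasDerivAt t ((hasDerivAt_line x v t).sub_const p)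
    have hlim : Tendsto (fun t : ℝ => inner ℝ e (x + t • v - p)) (𝓝 0) (𝓝 (inner ℝ e (x - p))) := by
      simpa using (hline 0).continuousAt.tendsto
    have hd2 : HasDerivAt (fun t : ℝ => ψ' (inner ℝ e (x + t • v - p))) (ψ'' * inner ℝ e v) 0 :=
      HasDerivAt.comp (h₂ := ψ') 0 (by simpa using hψ2) (hline 0)
    have := deriv_conditions_of_isLocalMax (a := 0)
      (h := fun t : ℝ => u (x + t • v) - φ (x + t • v) - ψ (inner ℝ e (x + t • v - p)))
      (h' := fun t : ℝ => fderiv ℝ u (x + t • v) v - fderiv ℝ φ (x + t • v) v -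
        ψ' (inner ℝ e (x + t • v - p)) * inner ℝ e v)
      (by simpa [IsLocalMax, IsMaxFilter] using (tendsto_line x v).eventually hmax)
      (by
        filter_upwards [eventually_hasDerivAt_line hu v, eventually_hasDerivAt_line hφ v,
          hlim.eventually hψ1] with t h1 h2 h3
        exact (h1.sub h2).sub (HasDerivAt.comp (h₂ := ψ) t h3 (hline t)))
      (((hasDerivAt_fderiv_line hu v).sub (hasDerivAt_fderiv_line hφ v)).sub
        (hd2.mul_const (inner ℝ e v)))
    simpa using this
  set G := gradient u x with hG
  -- Pair the first order condition Du = Dφ + ψ'e with G = Du itself.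
  have hGle : ‖G‖ ≤ M + a := by
    have h1 := (key G).1
    rw [← inner_gradient, ← hG, real_inner_self_eq_norm_sq] at h1
    have h2 : fderiv ℝ φ x G ≤ M * ‖G‖ :=
      (le_abs_self _).trans ((fderiv ℝ φ x).le_of_opNorm_le hφ1 G)
    have h3 : inner ℝ e G ≤ ‖G‖ := by
      simpa [he] using real_inner_le_norm e G
    have h4 : ‖G‖ * ‖G‖ ≤ (M + a) * ‖G‖ := by
      nlinarith
    rcases (norm_nonneg G).eq_or_lt with h | h
    · rw [← h]
      linarith
    · exact le_of_mul_le_mul_right h4 h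
  have hφv : ∀ v, fderiv ℝ (fderiv ℝ φ) x v v ≤ M * ‖v‖ ^ 2 := by
    intro v
    calc _ ≤ ‖fderiv ℝ (fderiv ℝ φ) x v v‖ := le_abs_self _
      _ ≤ ‖fderiv ℝ (fderiv ℝ φ) x‖ * ‖v‖ * ‖v‖ := ContinuousLinearMap.le_opNorm₂ _ _ _
      _ ≤ M * ‖v‖ * ‖v‖ := by gcongr
      _ = _ := by ring
  have hneg : ψ'' ≤ 0 := hψ''.trans (by simp only [Left.neg_nonpos_iff]; positivity)
  -- These are the three directions whose second derivatives sum to Qu.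
  have h0 := (key (EuclideanSpace.single 0 1)).2
  have h1 := (key (EuclideanSpace.single 1 1)).2
  have h2 := (key (rot G)).2
  have g0 := hφv (EuclideanSpace.single 0 1)
  have g1 := hφv (EuclideanSpace.single 1 1)
  have g2 := hφv (rot G)
  have hee : e 0 ^ 2 + e 1 ^ 2 = 1 := by rw [← norm_sq_eq, he, one_pow]
  rw [norm_rot] at g2
  simp only [PiLp.norm_single, norm_one, one_pow, mul_one, EuclideanSpace.inner_single_right,
    conj_trivial, one_mul] at h0 h1 g0 g1
  rw [meanCurvatureOperator, ← hG] at hop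
  have h3 : ψ'' * inner ℝ e (rot G) * inner ℝ e (rot G) ≤ 0 := by
    rw [mul_assoc]
    exact mul_nonpos_of_nonpos_of_nonneg hneg (mul_self_nonneg _)
  have h4 : ψ'' * e 0 * e 0 + ψ'' * e 1 * e 1 = ψ'' := by linear_combination ψ'' * hee
  have h5 : ‖G‖ ^ 2 ≤ (M + 1) ^ 2 * a ^ 2 := by
    rw [← mul_pow]
    exact pow_le_pow_left₀ (norm_nonneg _) (hGle.trans (by nlinarith)) 2
  -- Of the four copies of (M + 1)³a², one pays for (M + 1)|G|² and three strictly exceed 1 + 2M,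
  -- because a ≥ 1.
  have h6 : 4 * (M + 1) ^ 3 * a ^ 2 ≤ 1 + 2 * M + (M + 1) * ((M + 1) ^ 2 * a ^ 2) := by
    have := mul_le_mul_of_nonneg_left h5 (show 0 ≤ M + 1 by linarith)
    linarith
  have h7 : 1 ≤ a ^ 2 := one_le_pow₀ hψ'
  have h8 : (1 + 2 * M) < 3 * (M + 1) ^ 3 := by nlinarith [pow_nonneg hM 3, pow_nonneg hM 2]
  have h9 : 3 * (M + 1) ^ 3 * 1 ≤ 3 * (M + 1) ^ 3 * a ^ 2 :=
    mul_le_mul_of_nonneg_left h7 (by positivity)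
  linarith

/-- The profile of the barrier. -/
noncomputable def barrier (K c s : ℝ) : ℝ := Real.log (1 + K * c * s) / K

theorem barrier_nonneg {K c s : ℝ} (hK : 0 < K) (hc : 0 < c) (hs : 0 ≤ s) : 0 ≤ barrier K c s :=
  div_nonneg (Real.log_nonneg (le_add_of_nonneg_right (by positivity))) hK.le

theorem barrier_le {K c s : ℝ} (hK : 0 < K) (hc : 0 < c) (hs : 0 ≤ s) : barrier K c s ≤ c * s := by
  rw [barrier, div_le_iff₀ hK]
  have : 0 < 1 + K * c * s := by positivity
  linarith [Real.log_le_sub_one_of_pos this]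

theorem hasDerivAt_barrier {K c s : ℝ} (hK : 0 < K) (hs : 0 < 1 + K * c * s) :
    HasDerivAt (barrier K c) (c / (1 + K * c * s)) s := by
  have h1 : HasDerivAt (fun s => 1 + K * c * s) (K * c) s := by
    simpa using ((hasDerivAt_id s).const_mul (K * c)).const_add 1
  refine ((h1.log hs.ne').div_const K).congr_deriv ?_
  field_simp

/-- This is the equation ψ'' = -Kψ'², which dictates the logarithm: it is the equality case of the
condition on ψ'' in `not_isLocalMax_sub_barrier`. -/
theorem hasDerivAt_deriv_barrier {K c s : ℝ} (hs : 0 < 1 + K * c * s) :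
    HasDerivAt (fun s => c / (1 + K * c * s)) (-(K * (c / (1 + K * c * s)) ^ 2)) s := by
  have h1 : HasDerivAt (fun s => 1 + K * c * s) (K * c) s := by
    simpa using ((hasDerivAt_id s).const_mul (K * c)).const_add 1
  refine ((hasDerivAt_const s c).div h1 hs.ne').congr_deriv ?_
  field_simp
  ring

theorem continuousOn_barrier {K c : ℝ} (hK : 0 < K) (hc : 0 < c) :
    ContinuousOn (barrier K c) (Ici 0) := fun s (hs : 0 ≤ s) =>
  (hasDerivAt_barrier hK (by positivity)).continuousAt.continuousWithinAt

/-- Comparison with the barrier in the part of `Ω` at distance less than `δ` from a supporting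
line. -/
theorem le_add_barrier {Ω : Set Plane} (ho : IsOpen Ω) (hb : Bornology.IsBounded Ω) {p e : Plane}
    (he : ‖e‖ = 1) (hl : ∀ x ∈ Ω, 0 < inner ℝ e (x - p)) {u φ : Plane → ℝ} {ε δ c B : ℝ} {M : ℝ≥0}
    (hδε : δ < ε) (hc : 0 < c)
    (hcδ : 1 + 4 * ((M : ℝ) + 1) ^ 3 * c * δ ≤ c)
    (hB : B ≤ barrier (4 * ((M : ℝ) + 1) ^ 3) c δ)
    (hφc : ContinuousOn φ (closure (innerTube Ω ε))) (hφ : ContDiffOn ℝ 2 φ (innerTube Ω ε))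
    (hφM : c2Norm φ (innerTube Ω ε) ≤ M)
    (huc : ContinuousOn u (closure Ω)) (hu : ContDiffOn ℝ 2 u Ω)
    (hop : ∀ x ∈ Ω, -(1 + ‖gradient u x‖ ^ 2) ≤ meanCurvatureOperator u x)
    (hbd : ∀ x ∈ frontier Ω, u x = φ x) (huB : ∀ x ∈ innerTube Ω ε, u x - φ x ≤ B) :
    ∀ x ∈ Ω, inner ℝ e (x - p) < δ →
      u x ≤ φ x + barrier (4 * ((M : ℝ) + 1) ^ 3) c (inner ℝ e (x - p)) := by
  intro x hx hxδ
  set K : ℝ := 4 * ((M : ℝ) + 1) ^ 3 with hK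
  have hK0 : 0 < K := by positivity
  have hlc : Continuous fun y : Plane => inner ℝ e (y - p) := by fun_prop
  set D : Set Plane := Ω ∩ {y | inner ℝ e (y - p) < δ} with hD
  have hDo : IsOpen D := ho.inter (isOpen_lt hlc continuous_const)
  have htube : ∀ y ∈ Ω, inner ℝ e (y - p) ≤ δ → y ∈ innerTube Ω ε := fun y hy hyδ =>
    ⟨hy, ((infDist_frontier_le_inner ho he hl hy).trans hyδ).trans_lt hδε⟩
  have hDt : D ⊆ innerTube Ω ε := fun y hy => htube y hy.1 (le_of_lt hy.2)
  have hDΩ : closure D ⊆ closure Ω := closure_mono inter_subset_left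
  have hDδ : closure D ⊆ {y | inner ℝ e (y - p) ≤ δ} :=
    closure_minimal (fun y hy => show inner ℝ e (y - p) ≤ δ from le_of_lt hy.2)
      (isClosed_le hlc continuous_const)
  have hD0 : closure D ⊆ {y | 0 ≤ inner ℝ e (y - p)} :=
    closure_minimal (fun y hy => (hl y hy.1).le) (isClosed_le continuous_const hlc)
  have hcomp : IsCompact (closure D) := (hb.subset inter_subset_left).isCompact_closure
  have hcont : ContinuousOn (fun y => u y - φ y - barrier K c (inner ℝ e (y - p))) (closure D) :=
    ((huc.mono hDΩ).sub (hφc.mono (closure_mono hDt))).sub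
      ((continuousOn_barrier hK0 hc).comp hlc.continuousOn hD0)
  obtain ⟨z, hz, hmax⟩ := hcomp.exists_isMaxOn ⟨x, subset_closure ⟨hx, hxδ⟩⟩ hcont
  have hzx := hmax (subset_closure (show x ∈ D from ⟨hx, hxδ⟩))
  simp only [mem_ofPred_eq] at hzx
  have hz0 : 0 ≤ inner ℝ e (z - p) := hD0 hz
  have hzδ : inner ℝ e (z - p) ≤ δ := hDδ hz
  suffices h : u z - φ z ≤ barrier K c (inner ℝ e (z - p)) by linarith
  -- The maximum point is on the far side d = δ, where `hB` and `huB` apply, or inside the strip,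
  -- which is excluded, or on the frontier of Ω, where u = φ and ψ ≥ 0.
  by_cases hzΩ : z ∈ Ω
  · rcases hzδ.eq_or_lt with h | h
    · rw [h]
      exact (huB z (htube z hzΩ hzδ)).trans hB
    · exfalso
      have hzD : z ∈ D := ⟨hzΩ, h⟩
      have hzt := hDt hzD
      have hpos : 0 < 1 + K * c * inner ℝ e (z - p) := by positivity
      refine not_isLocalMax_sub_barrier (ψ := barrier K c)
        (ψ' := fun s => c / (1 + K * c * s)) M.2 he
        (hu.contDiffAt (ho.mem_nhds hzΩ)) (hφ.contDiffAt ((isOpen_innerTube ho ε).mem_nhds hzt))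
        (norm_fderiv_le_of_c2Norm_le hφM hzt) (norm_fderiv_fderiv_le_of_c2Norm_le hφM hzt)
        ?_ (hasDerivAt_deriv_barrier hpos) ?_ le_rfl (hop z hzΩ)
        (hmax.isLocalMax (mem_of_superset (hDo.mem_nhds hzD) subset_closure))
      · filter_upwards [lt_mem_nhds (hl z hzΩ)] with s hs
        exact hasDerivAt_barrier hK0 (by positivity)
      -- ψ' is decreasing, and `hcδ` says that it is still at least 1 at δ.
      · rw [one_le_div hpos]
        refine le_trans ?_ hcδ
        gcongr
  · have hzf : z ∈ frontier Ω := by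
      rw [ho.frontier_eq]
      exact ⟨hDΩ hz, hzΩ⟩
    rw [hbd z hzf, sub_self]
    exact barrier_nonneg hK0 hc hz0

/-- The maximum principle for solutions. -/
theorem le_of_frontier_le {Ω : Set Plane} (ho : IsOpen Ω) (hb : Bornology.IsBounded Ω)
    {u : Plane → ℝ} {m : ℝ} (huc : ContinuousOn u (closure Ω)) (hu : ContDiffOn ℝ 2 u Ω)
    (hop : ∀ x ∈ Ω, 0 < meanCurvatureOperator u x)
    (hbd : ∀ x ∈ frontier Ω, u x ≤ m) : ∀ x ∈ Ω, u x ≤ m := by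
  intro x hx
  obtain ⟨z, hz, hmax⟩ := hb.isCompact_closure.exists_isMaxOn ⟨x, subset_closure hx⟩ huc
  refine (hmax (subset_closure hx)).trans ?_
  by_cases hzΩ : z ∈ Ω
  · exfalso
    have hloc : IsLocalMax u z := hmax.isLocalMax (mem_of_superset (ho.mem_nhds hzΩ) subset_closure)
    have hC := hu.contDiffAt (ho.mem_nhds hzΩ)
    -- All three terms of Qu are then nonpositive, against Qu > 0.
    have key : ∀ v, fderiv ℝ (fderiv ℝ u) z v v ≤ 0 := fun v =>
      (deriv_conditions_of_isLocalMax (a := 0) (h := fun t : ℝ => u (z + t • v))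
        (by simpa [IsLocalMax, IsMaxFilter] using (tendsto_line z v).eventually hloc)
        (eventually_hasDerivAt_line hC v) (hasDerivAt_fderiv_line hC v)).2
    have := hop z hzΩ
    rw [meanCurvatureOperator] at this
    linarith [key (EuclideanSpace.single 0 1), key (EuclideanSpace.single 1 1),
      key (rot (gradient u z))]
  · refine hbd z ?_
    rw [ho.frontier_eq]
    exact ⟨hz, hzΩ⟩


/-! ### From boundary growth to the gradient, supporting lines, parameters -/

/-- A boundary growth bound passes to the gradient in directions that point into `Ω`. -/
theorem IsC1OnClosure.abs_inner_le {Ω : Set Plane} (ho : IsOpen Ω) (hconv : Convex ℝ Ω)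
    {u : Plane → ℝ} {Du : Plane → Plane} (h : IsC1OnClosure u Du Ω) {p : Plane} {L : ℝ}
    (hp : p ∈ frontier Ω) (hL : ∀ᶠ x in 𝓝[Ω] p, |u x - u p| ≤ L * ‖x - p‖) {x : Plane}
    (hx : x ∈ Ω) : |inner ℝ (Du p) (x - p)| ≤ L * ‖x - p‖ := by
  have hmem : ∀ t ∈ Ioc (0 : ℝ) 1, p + t • (x - p) ∈ Ω := by
    intro t ht
    have := hconv.add_smul_sub_mem_interior' hp.1 (by rwa [ho.interior_eq]) ht
    rwa [ho.interior_eq] at this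
  have hev : ∀ᶠ t : ℝ in 𝓝[>] 0, p + t • (x - p) ∈ Ω := by
    filter_upwards [Ioc_mem_nhdsGT one_pos] with t ht using hmem t ht
  have hlim : Tendsto (fun t : ℝ => p + t • (x - p)) (𝓝[>] 0) (𝓝 p) :=
    (tendsto_line p (x - p)).mono_left nhdsWithin_le_nhds
  have hlimΩ : Tendsto (fun t : ℝ => p + t • (x - p)) (𝓝[>] 0) (𝓝[Ω] p) :=
    tendsto_nhdsWithin_iff.2 ⟨hlim, hev⟩
  have hder : ∀ t ∈ Ioc (0 : ℝ) 1, HasDerivAt (fun t : ℝ => u (p + t • (x - p)))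
      (inner ℝ (Du (p + t • (x - p))) (x - p)) t := by
    intro t ht
    exact (h.hasGradientAt _ (hmem t ht)).hasFDerivAt.comp_hasDerivAt t (hasDerivAt_line p (x - p) t)
  have hDu : Tendsto (fun t : ℝ => inner ℝ (Du (p + t • (x - p))) (x - p)) (𝓝[>] 0)
      (𝓝 (inner ℝ (Du p) (x - p))) :=
    (((h.continuousOn_gradient p hp.1).mono_left (nhdsWithin_mono _ subset_closure)).comp
      hlimΩ).inner tendsto_const_nhds
  -- Du(p) is only a limit of interior gradients; since the derivatives along the segment converge,
  -- it is also the one-sided derivative, and the growth bound controls the slopes.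
  have hd : HasDerivWithinAt (fun t : ℝ => u (p + t • (x - p))) (inner ℝ (Du p) (x - p)) (Ici 0) 0 := by
    refine hasDerivWithinAt_Ici_of_tendsto_deriv (s := Ioc 0 1)
      (fun t ht => (hder t ht).differentiableAt.differentiableWithinAt) ?_ (Ioc_mem_nhdsGT one_pos) ?_
    · have := ((h.continuousOn p hp.1).mono_left (nhdsWithin_mono _ subset_closure)).comp hlimΩ
      have h2 : Tendsto (fun t : ℝ => u (p + t • (x - p))) (𝓝[Ioc 0 1] 0) (𝓝 (u p)) :=
        this.mono_left (nhdsWithin_mono _ fun t ht => ht.1)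
      simpa [ContinuousWithinAt] using h2
    · refine hDu.congr' ?_
      filter_upwards [Ioc_mem_nhdsGT one_pos] with t ht using (hder t ht).deriv.symm
  have hslope := ((hasDerivWithinAt_iff_tendsto_slope' self_notMem_Ioi).1
    (hd.mono Ioi_subset_Ici_self)).abs
  refine le_of_tendsto hslope ?_
  filter_upwards [hlimΩ.eventually hL, self_mem_nhdsWithin] with t ht (ht0 : 0 < t)
  rw [slope_def_field, abs_div, sub_zero, abs_of_pos ht0, div_le_iff₀ ht0]
  rw [add_sub_cancel_left, norm_smul, Real.norm_of_nonneg ht0.le] at ht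
  simp only [zero_smul, add_zero]
  linarith

/-- A function with bounded gradient is Lipschitz up to the boundary of a convex set. -/
theorem abs_sub_le_of_mem_closure {D : Set Plane} {φ : Plane → ℝ} {M : ℝ} (hconv : Convex ℝ D)
    (hd : ∀ x ∈ D, DifferentiableAt ℝ φ x) (hM : ∀ x ∈ D, ‖fderiv ℝ φ x‖ ≤ M)
    {p : Plane} (hp : p ∈ closure D) (hφ : ContinuousWithinAt φ D p) {x : Plane} (hx : x ∈ D) :
    |φ x - φ p| ≤ M * ‖x - p‖ := by
  have : (𝓝[D] p).NeBot := mem_closure_iff_nhdsWithin_neBot.1 hp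
  have h1 : Tendsto (fun y => |φ x - φ y|) (𝓝[D] p) (𝓝 |φ x - φ p|) :=
    (tendsto_const_nhds.sub hφ).abs
  have h2 : Tendsto (fun y => M * ‖x - y‖) (𝓝[D] p) (𝓝 (M * ‖x - p‖)) := by
    have : Continuous fun y => M * ‖x - y‖ := by fun_prop
    exact (this.tendsto p).mono_left nhdsWithin_le_nhds
  refine le_of_tendsto_of_tendsto h1 h2 ?_
  filter_upwards [self_mem_nhdsWithin] with y hy
  exact hconv.norm_image_sub_le_of_norm_fderiv_le hd hM hy hx

theorem exists_unit_normal {Ω : Set Plane} (ho : IsOpen Ω) (hconv : Convex ℝ Ω) (hne : Ω.Nonempty)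
    {p : Plane} (hp : p ∉ Ω) : ∃ e : Plane, ‖e‖ = 1 ∧ ∀ x ∈ Ω, 0 < inner ℝ e (x - p) := by
  obtain ⟨f, hf⟩ := geometric_hahn_banach_point_open hconv ho hp
  set v := (InnerProductSpace.toDual ℝ Plane).symm f with hv
  have hfv : ∀ x ∈ Ω, 0 < inner ℝ v (x - p) := by
    intro x hx
    rw [hv, InnerProductSpace.toDual_symm_apply, map_sub]
    linarith [hf x hx]
  have hv0 : v ≠ 0 := by
    rintro h
    obtain ⟨x, hx⟩ := hne
    simpa [h] using hfv x hx
  refine ⟨‖v‖⁻¹ • v, norm_smul_inv_norm (𝕜 := ℝ) hv0, fun x hx => ?_⟩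
  rw [real_inner_smul_left]
  exact mul_pos (inv_pos.2 (norm_pos_iff.2 hv0)) (hfv x hx)

/-- Through this, continuity on the closed tube carries bounds on φ to the boundary. -/
theorem frontier_subset_closure_innerTube {Ω : Set Plane} {ε : ℝ} (hε : 0 < ε) :
    frontier Ω ⊆ closure (innerTube Ω ε) := by
  intro p hp
  have hev : ∀ᶠ x in 𝓝 p, Metric.infDist x (frontier Ω) < ε := by
    refine (Metric.continuous_infDist_pt (frontier Ω)).continuousAt.eventually_lt
      continuousAt_const ?_
    rwa [Metric.infDist_zero_of_mem hp]
  exact mem_closure_iff_frequently.2 ((mem_closure_iff_frequently.1 hp.1).and_eventually hev)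

/-- Parameters for which the barrier exists; they do not depend on `φ` and `u`. -/
theorem exists_barrier_parameters {K ε : ℝ} (hK : 0 < K) (hε : 0 < ε) (B : ℝ) :
    ∃ δ c : ℝ, 0 < δ ∧ δ < ε ∧ 0 < c ∧ 1 + K * c * δ ≤ c ∧ B ≤ barrier K c δ := by
  -- Kδ ≤ 1/2 and c ≥ 2 give 1 + Kcδ ≤ 1 + c/2 ≤ c. The other entry of the maximum defining c gives
  -- Kcδ ≥ exp(KB), so the barrier reaches B at δ.
  set δ := min (ε / 2) (1 / (2 * K)) with hδ
  have hδ0 : 0 < δ := by positivity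
  have hKδ : K * δ ≤ 1 / 2 := by
    have := mul_le_mul_of_nonneg_left (min_le_right (ε / 2) (1 / (2 * K))) hK.le
    rw [← hδ] at this
    refine this.trans (le_of_eq ?_)
    field_simp
  set c := max 2 (Real.exp (K * B) / (K * δ)) with hc
  have hc2 : 2 ≤ c := le_max_left _ _
  have hc0 : 0 < c := by linarith
  refine ⟨δ, c, hδ0, (min_le_left _ _).trans_lt (by linarith), hc0, by nlinarith, ?_⟩
  rw [barrier, le_div_iff₀ hK, Real.le_log_iff_exp_le (by positivity), mul_comm B]
  have : Real.exp (K * B) ≤ c * (K * δ) := (div_le_iff₀ (by positivity)).1 (le_max_right _ _)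
  linarith

end Soliton

/-! ### The boundary gradient estimate -/

open Soliton Set Filter Topology in
theorem proposition4p2 (Ω : Set Soliton.Plane) (hΩ : Soliton.IsC2Domain Ω)
    (hbdd : Bornology.IsBounded Ω)
    (hκ : ∀ p ∈ frontier Ω, ∀ κ : ℝ, Soliton.HasInwardCurvature Ω p κ → 0 ≤ κ)
    (ε : ℝ) (hε : 0 < ε) (C₁ : ℝ) (M : ℝ≥0) :
    ∃ C₂ : ℝ, ∀ (φ u : Soliton.Plane → ℝ) (Du : Soliton.Plane → Soliton.Plane),
      Soliton.IsC2OnClosure φ (Soliton.innerTube Ω ε) →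
      Soliton.c2Norm φ (Soliton.innerTube Ω ε) ≤ M →
      ContDiffOn ℝ 2 u Ω →
      Soliton.IsC1OnClosure u Du Ω →
      Soliton.SolvesTranslatingSoliton u Ω →
      (∀ x ∈ frontier Ω, u x = φ x) →
      (∀ x ∈ Ω, C₁ ≤ u x) →
      ∀ x ∈ frontier Ω, ‖Du x‖ ≤ C₂ := by
  have ho := hΩ.isOpen
  have hconv := hΩ.convex hκ
  obtain ⟨x₀, hx₀⟩ := hΩ.isConnected.nonempty
  obtain ⟨r, hr, hball⟩ := Metric.isOpen_iff.1 ho x₀ hx₀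
  obtain ⟨R, hR⟩ := Metric.isBounded_iff.1 hbdd.closure
  -- 2M + |C₁| dominates both u - φ ≤ 2M and φ - u ≤ M + |C₁| in the tube.
  obtain ⟨δ, c, hδ, hδε, hc, hcδ, hB⟩ := exists_barrier_parameters
    (K := 4 * ((M : ℝ) + 1) ^ 3) (by positivity) hε (2 * M + |C₁|)
  refine ⟨2 * ((M + c) * R) / (r / 2), ?_⟩
  intro φ u Du hφ hφM hu hu1 hsol hbd hlow p hp
  have hop : ∀ x ∈ Ω, meanCurvatureOperator u x = 1 + ‖gradient u x‖ ^ 2 := fun x hx =>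
    hsol.meanCurvatureOperator_eq hx (hu.contDiffAt (ho.mem_nhds hx))
  have hφb : ∀ x ∈ innerTube Ω ε, |φ x| ≤ M := fun x hx => abs_le_of_c2Norm_le hφM hx
  have hφbf : ∀ x ∈ frontier Ω, |φ x| ≤ M := fun x hx =>
    ContinuousWithinAt.closure_le (frontier_subset_closure_innerTube hε hx)
      ((hφ.1.abs x (frontier_subset_closure_innerTube hε hx)).mono subset_closure)
      continuousWithinAt_const hφb
  have hup : ∀ x ∈ Ω, u x ≤ M := le_of_frontier_le ho hbdd hu1.continuousOn hu
    (fun x hx => by rw [hop x hx]; positivity)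
    (fun x hx => by rw [hbd x hx]; exact (le_abs_self _).trans (hφbf x hx))
  have hpΩ : p ∉ Ω := by
    rw [ho.frontier_eq] at hp
    exact hp.2
  obtain ⟨e, he, hl⟩ := exists_unit_normal ho hconv ⟨x₀, hx₀⟩ hpΩ
  have hupper := le_add_barrier ho hbdd he hl hδε hc hcδ hB hφ.1 hφ.2.1 hφM hu1.continuousOn hu
    (fun x hx => by rw [hop x hx]; nlinarith [sq_nonneg ‖gradient u x‖]) hbd
    (fun x hx => by
      have := neg_abs_le (φ x)
      linarith [hup x hx.1, hφb x hx, abs_nonneg C₁])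
  have hlower := le_add_barrier (u := -u) (φ := -φ) ho hbdd he hl hδε hc hcδ hB hφ.1.neg hφ.2.1.neg
    (by rwa [c2Norm_neg]) hu1.continuousOn.neg hu.neg
    (fun x hx => by rw [meanCurvatureOperator_neg, hop x hx, gradient_neg, norm_neg])
    (fun x hx => by simp [hbd x hx])
    (fun x hx => by
      have := le_abs_self (φ x)
      have := neg_abs_le C₁
      simp only [Pi.neg_apply]
      linarith [hlow x hx.1, hφb x hx, M.2])
  set D : Set Plane := Ω ∩ {x | inner ℝ e (x - p) < δ} with hD
  have hlc : Continuous fun y : Plane => inner ℝ e (y - p) := by fun_prop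
  -- The tube need not be convex; the strip is, so the mean value inequality for φ holds there.
  have hDconv : Convex ℝ D := by
    refine hconv.inter ?_
    have : {x : Plane | inner ℝ e (x - p) < δ} = {x | innerSL ℝ e x < δ + inner ℝ e p} := by
      ext x
      simp [inner_sub_right, sub_lt_iff_lt_add]
    rw [this]
    exact convex_halfSpace_lt (innerSL ℝ e).isLinear _
  have hDt : D ⊆ innerTube Ω ε := fun y hy =>
    ⟨hy.1, ((infDist_frontier_le_inner ho he hl hy.1).trans_lt hy.2).trans hδε⟩
  have hDn : ∀ᶠ x in 𝓝[Ω] p, x ∈ D := by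
    have : ∀ᶠ x in 𝓝 p, inner ℝ e (x - p) < δ :=
      hlc.continuousAt.eventually_lt continuousAt_const (by simpa using hδ)
    filter_upwards [self_mem_nhdsWithin, nhdsWithin_le_nhds this] with x h1 h2 using ⟨h1, h2⟩
  have hpD : p ∈ closure D := by
    have : (𝓝[Ω] p).NeBot := mem_closure_iff_nhdsWithin_neBot.1 hp.1
    exact mem_closure_of_tendsto (tendsto_id.mono_left nhdsWithin_le_nhds) hDn
  have hgrowth : ∀ᶠ x in 𝓝[Ω] p, |u x - u p| ≤ (M + c) * ‖x - p‖ := by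
    filter_upwards [hDn] with x hx
    have h1 := hupper x hx.1 hx.2
    have h2 := hlower x hx.1 hx.2
    have h3 := barrier_le (K := 4 * ((M : ℝ) + 1) ^ 3) (by positivity) hc (hl x hx.1).le
    have h4 : inner ℝ e (x - p) ≤ ‖x - p‖ := by simpa [he] using real_inner_le_norm e (x - p)
    have h5 := abs_le.1 (abs_sub_le_of_mem_closure hDconv
      (fun y hy => (hφ.2.1.contDiffAt ((isOpen_innerTube ho ε).mem_nhds
        (hDt hy))).differentiableAt (by norm_num))
      (fun y hy => norm_fderiv_le_of_c2Norm_le hφM (hDt hy)) hpD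
      ((hφ.1 p (frontier_subset_closure_innerTube hε hp)).mono (hDt.trans subset_closure)) hx)
    have h6 := mul_le_mul_of_nonneg_left h4 hc.le
    simp only [Pi.neg_apply] at h2
    rw [hbd p hp, abs_le]
    constructor <;> linarith [h5.1, h5.2]
  have hcone : ∀ x ∈ Ω, |inner ℝ (Du p) (x - p)| ≤ (M + c) * R := by
    intro x hx
    refine (hu1.abs_inner_le ho hconv hp hgrowth hx).trans ?_
    rw [← dist_eq_norm]
    exact mul_le_mul_of_nonneg_left (hR (subset_closure hx) hp.1) (by positivity)
  rw [le_div_iff₀ (by positivity)]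
  rcases (norm_nonneg (Du p)).eq_or_lt with h0 | h0
  · have := (abs_nonneg _).trans (hcone x₀ hx₀)
    rw [← h0]
    linarith
  -- Moving by r/2 along Du(p) stays in the ball and raises ⟨Du(p), · - p⟩ by |Du(p)|r/2, while both
  -- values are at most (M + c)R in modulus.
  set y := x₀ + (r / 2) • (‖Du p‖⁻¹ • Du p) with hy
  have hyΩ : y ∈ Ω := by
    apply hball
    rw [Metric.mem_ball, dist_eq_norm, hy, add_sub_cancel_left, norm_smul,
      norm_smul, norm_inv, norm_norm, inv_mul_cancel₀ h0.ne', Real.norm_of_nonneg (by positivity)]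
    linarith
  have h1 := (abs_le.1 (hcone y hyΩ)).2
  have h2 := (abs_le.1 (hcone x₀ hx₀)).1
  have h3 : inner ℝ (Du p) (y - p) = inner ℝ (Du p) (x₀ - p) + ‖Du p‖ * (r / 2) := by
    rw [hy, add_sub_right_comm, inner_add_right, inner_smul_right, inner_smul_right,
      real_inner_self_eq_norm_sq]
    field_simp
  linarith
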